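/- Let $G$ be a finite group with identity $e$, let $N_1,\dots,N_k$ be normal subgroups of $G$, and let $A=A(N_1,\dots,N_k)$ be the smallest family of normal subgroups of $G$ that contains $\{e\}$, $G$ and $N_1,\dots,N_k$ and is closed under products $HK=\{hk: h\in H,\ k\in K\}$ and intersections. For $N\in A$ put $$N^\circ = N\setminus \bigcup_{K\in A,\ K<N} K ,$$ where $K<N$ means that $K$ is properly contained in $N$. Then $$\mathcal K=\{N^\circ : N\in A,\ N^\circ\neq\emptyset\}$$ is the set of superclasses of a supercharacter theory of $G$. That is, $\mathcal K$ is a partition of $G$ with $\{e\}\in\mathcal K$, and there is a partition $\mathcal X$ of the set $\mathrm{Irr}(G)$ of irreducible complex characters of $G$ such that $|\mathcal X|=|\mathcal K|$ and for each $X\in\mathcal X$ there is a nonzero character $\chi_X$ of $G$, all of whose irreducible constituents lie in $X$, that is constant on every member of $\mathcal K$. -/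

import Mathlib

open scoped Pointwise

namespace SuperChar

/-- `ψ` is the character of a finite-dimensional complex representation of `G`
(the zero-dimensional one is allowed, so that the zero function is included). -/
def IsCharacter {G : Type*} [Group G] (ψ : G → ℂ) : Prop :=
  ∃ (n : ℕ) (ρ : Representation ℂ G (Fin n → ℂ)), ψ = ρ.character

/-- The set `Irr(G)` of irreducible complex characters of `G`. -/
def Irr (G : Type*) [Group G] : Set (G → ℂ) :=
  {χ | ∃ (n : ℕ) (ρ : Representation ℂ G (Fin n → ℂ)), ρ.IsIrreducible ∧ χ = ρ.character}

/-- The irreducible character `χ` is a constituent of `ψ`: `ψ - χ` is a character or zero. -/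
def IsConstituent {G : Type*} [Group G] (χ : Irr G) (ψ : G → ℂ) : Prop :=
  ∃ θ : G → ℂ, IsCharacter θ ∧ ψ = (χ : G → ℂ) + θ

/-- `(𝒳, 𝒦)` is a supercharacter theory of `G`. -/
structure IsSupercharacterTheory {G : Type*} [Group G]
    (𝒳 : Set (Set (Irr G))) (𝒦 : Set (Set G)) : Prop where
  partition_irr : Setoid.IsPartition 𝒳
  partition_group : Setoid.IsPartition 𝒦
  card_eq : 𝒦.encard = 𝒳.encard
  exists_supercharacter : ∀ X ∈ 𝒳, ∃ ψ : G → ℂ, IsCharacter ψ ∧ ψ ≠ 0 ∧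
    (∀ χ : Irr G, IsConstituent χ ψ → χ ∈ X) ∧
    ∀ C ∈ 𝒦, ∀ g ∈ C, ∀ h ∈ C, ψ g = ψ h
  one_mem : ({1} : Set G) ∈ 𝒦

/-- `𝒦` is the set of superclasses of some supercharacter theory of `G`. -/
def IsSuperclassTheory {G : Type*} [Group G] (𝒦 : Set (Set G)) : Prop :=
  ∃ 𝒳 : Set (Set (Irr G)), IsSupercharacterTheory 𝒳 𝒦

/-- Membership in the smallest family of subgroups that contains `S`, the trivial subgroup and `G`
and is closed under products `H * K = {h * k | h ∈ H, k ∈ K}` and intersections.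
The product `H * K` is a subgroup whenever `H` and `K` are normal. -/
inductive GeneratedFamily {G : Type*} [Group G] (S : Set (Subgroup G)) : Subgroup G → Prop
  | bot : GeneratedFamily S ⊥
  | top : GeneratedFamily S ⊤
  | of (H : Subgroup G) : H ∈ S → GeneratedFamily S H
  | mul (H K L : Subgroup G) : GeneratedFamily S H → GeneratedFamily S K →
      (L : Set G) = (H : Set G) * (K : Set G) → GeneratedFamily S L
  | inter (H K : Subgroup G) : GeneratedFamily S H → GeneratedFamily S K →
      GeneratedFamily S (H ⊓ K)

/-- The family `A(N₁, …, N_k)`. -/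
def familyA {G : Type*} [Group G] {k : ℕ} (N : Fin k → Subgroup G) : Set (Subgroup G) :=
  {H | GeneratedFamily (Set.range N) H}

/-- `H° = H \ ⋃ {K ∈ 𝒜 : K < H}`. -/
def circ {G : Type*} [Group G] (𝒜 : Set (Subgroup G)) (H : Subgroup G) : Set G :=
  (H : Set G) \ ⋃ K ∈ {K : Subgroup G | K ∈ 𝒜 ∧ K < H}, (K : Set G)

end SuperChar

namespace SuperChar

/-! ### Möbius inversion and orthogonal idempotents -/

section Moebius

variable {L R : Type*} [Fintype L]

/-! For normal subgroups the averages `e_H` in the group algebra are central and satisfy `e_{HK} =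
e_H e_K`. Möbius inversion over the lattice `A` writes `e_H` as the sum of `f_K` over `K ≥ H`, and
multiplicativity makes the `f_K` orthogonal central idempotents (`moebius_mul_moebius`). They sum to
`e_⊥ = 1`, so each irreducible character is nonzero on exactly one `f_K`; this partitions `Irr G`.
The supercharacter of the block of `f_K` is the character of the ideal generated by `f_K`, whose
value at `g` is `|G|` times the coefficient of `f_K` at `g⁻¹`. As `f_K` is a combination of
averages, that coefficient depends only on which members of `A` contain `g`, hence is constant on
each `H°`. For the count (`card_idempotents_eq_card_circ`), the nonzero `f_K` form a basis of the
span of the averages, and the nonzero indicators of the `H°` a basis of the span of the indicators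
of the `H`. These spans agree, since an average is a scaled indicator. -/

open Classical in
theorem sum_ge_eq_add_sum_gt [PartialOrder L] {M : Type*} [AddCommMonoid M] (f : L → M) (a : L) :
    ∑ b with a ≤ b, f b = f a + ∑ b with a < b, f b := by
  have h : (Finset.univ.filter fun b => a ≤ b) = insert a (Finset.univ.filter fun b => a < b) := by
    ext b
    simp [le_iff_eq_or_lt, eq_comm]
  rw [h, Finset.sum_insert (by simp)]

open Classical in
/-- Möbius inversion on a finite partial order, as an existence statement. -/
theorem exists_eq_sum_ge [PartialOrder L] {M : Type*} [AddCommGroup M] (e : L → M) :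
    ∃ f : L → M, ∀ a, e a = ∑ b with a ≤ b, f b := by
  -- Solve for `f a` by recursion from the top: `e a` minus the values already found strictly above
  -- `a`.
  let F : (a : L) → ((b : L) → a < b → M) → M :=
    fun a g => e a - ∑ b, if h : a < b then g b h else 0
  have wf : WellFounded fun a b : L => b < a := wellFounded_gt
  refine ⟨wf.fix F, fun a => ?_⟩
  rw [sum_ge_eq_add_sum_gt, wf.fix_eq]
  simp only [F, Finset.sum_filter, dite_eq_ite, sub_add_cancel]

-- Used with three choices of `p`: the span of the `e a`, the centre of the group algebra, and the
-- elements with equal coefficients at two given points.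
open Classical in
theorem mem_of_eq_sum_ge [PartialOrder L] {M : Type*} [AddCommGroup M] [Module ℂ M]
    {e f : L → M} (hf : ∀ a, e a = ∑ b with a ≤ b, f b) (p : Submodule ℂ M) (he : ∀ a, e a ∈ p)
    (a : L) : f a ∈ p := by
  induction a using WellFoundedGT.induction with
  | ind a ih =>
    have h := hf a
    rw [sum_ge_eq_add_sum_gt] at h
    rw [show f a = e a - ∑ b with a < b, f b by rw [h]; abel]
    exact p.sub_mem (he a) (p.sum_mem fun b hb => ih b (by simpa using hb))

open Classical in
theorem span_eq_of_eq_sum_ge [PartialOrder L] {M : Type*} [AddCommGroup M] [Module ℂ M]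
    {e f : L → M} (hf : ∀ a, e a = ∑ b with a ≤ b, f b) :
    Submodule.span ℂ (Set.range f) = Submodule.span ℂ (Set.range e) := by
  apply le_antisymm
  · rw [Submodule.span_le]
    rintro _ ⟨a, rfl⟩
    exact mem_of_eq_sum_ge hf _ (fun b => Submodule.subset_span (Set.mem_range_self b)) a
  · rw [Submodule.span_le]
    rintro _ ⟨a, rfl⟩
    rw [hf a]
    exact Submodule.sum_mem _ fun b _ => Submodule.subset_span ⟨b, rfl⟩

variable [SemilatticeSup L] [Ring R] {e f : L → R}

open Classical in
theorem mul_moebius (hmul : ∀ a b, e (a ⊔ b) = e a * e b)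
    (hf : ∀ a, e a = ∑ b with a ≤ b, f b) (k a : L) :
    e k * f a = if k ≤ a then f a else 0 := by
  induction a using WellFoundedGT.induction with
  | ind a ih =>
    have h := hf a
    rw [sum_ge_eq_add_sum_gt] at h
    have hsum : e k * ∑ b with a < b, f b = ∑ b with a < b ∧ k ≤ b, f b := by
      rw [Finset.mul_sum, Finset.sum_congr rfl fun b hb => ih b (by simpa using hb),
        ← Finset.sum_filter, Finset.filter_filter]
    have hfa : f a = e a - ∑ b with a < b, f b := by rw [h]; abel
    split_ifs with hka
    · rw [hfa, mul_sub, hsum, ← hmul, sup_eq_right.mpr hka]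
      congr 2
      ext b
      simpa using fun hab => hka.trans hab.le
    -- When `k ≰ a`, the elements above `k ⊔ a` are exactly those above `k` and strictly above `a`,
    -- so the two sums cancel.
    · rw [hfa, mul_sub, hsum, ← hmul, hf (k ⊔ a), sub_eq_zero]
      congr 1
      ext b
      simp only [Finset.mem_filter, Finset.mem_univ, true_and, sup_le_iff]
      refine ⟨fun hb => ⟨lt_of_le_of_ne hb.2 ?_, hb.1⟩, fun hb => ⟨hb.2, hb.1.le⟩⟩
      rintro rfl
      exact hka hb.1

open Classical in
theorem moebius_mul_moebius (hmul : ∀ a b, e (a ⊔ b) = e a * e b)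
    (hf : ∀ a, e a = ∑ b with a ≤ b, f b) (k a : L) :
    f k * f a = if k = a then f a else 0 := by
  induction k using WellFoundedGT.induction with
  | ind k ih =>
    have h := hf k
    rw [sum_ge_eq_add_sum_gt] at h
    have hfk : f k = e k - ∑ b with k < b, f b := by rw [h]; abel
    rw [hfk, sub_mul, mul_moebius hmul hf, Finset.sum_mul,
      Finset.sum_congr rfl fun b hb => ih b (by simpa using hb), Finset.sum_ite_eq']
    simp only [Finset.mem_filter, Finset.mem_univ, true_and]
    by_cases hka : k = a
    · simp [hka]
    · by_cases hle : k ≤ a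
      · simp [hka, hle, lt_of_le_of_ne hle hka]
      · have : ¬ k < a := fun hlt => hle hlt.le
        simp [hka, hle, this]

open Classical in
/-- The span of a family of orthogonal idempotents has dimension the number of nonzero ones. -/
theorem finrank_span_orthogonal {ι R : Type*} [Fintype ι] [Ring R] [Algebra ℂ R] {f : ι → R}
    (h : ∀ i j, f i * f j = if i = j then f j else 0) :
    Module.finrank ℂ (Submodule.span ℂ (Set.range f)) = Nat.card {i // f i ≠ 0} := by
  have hspan : Submodule.span ℂ (Set.range f) =
      Submodule.span ℂ (Set.range fun i : {i // f i ≠ 0} => f i) := by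
    apply le_antisymm
    · rw [Submodule.span_le]
      rintro _ ⟨i, rfl⟩
      by_cases hi : f i = 0
      · rw [hi]; exact Submodule.zero_mem _
      · exact Submodule.subset_span ⟨⟨i, hi⟩, rfl⟩
    · apply Submodule.span_mono
      rintro _ ⟨i, rfl⟩
      exact ⟨i, rfl⟩
  have hli : LinearIndependent ℂ fun i : {i // f i ≠ 0} => f i := by
    rw [Fintype.linearIndependent_iff]
    intro c hc i
    -- Multiplying a relation by `f i` isolates its `i`-th term.
    have h1 := congrArg (fun x => x * f i) hc
    simp only [zero_mul, Finset.sum_mul, smul_mul_assoc, h, Subtype.coe_inj, smul_ite, smul_zero,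
      Finset.sum_ite_eq', Finset.mem_univ, if_true] at h1
    exact (smul_eq_zero.mp h1).resolve_right i.2
  rw [hspan, finrank_span_eq_card hli, Nat.card_eq_fintype_card]

end Moebius

/-! ### Averaging idempotents of normal subgroups -/

section Average

variable {G : Type*} [Group G] [Fintype G]

open Classical in
/-- The averaging element `|H|⁻¹ ∑_{h ∈ H} h` of the group algebra. -/
noncomputable def subgroupAverage (H : Subgroup G) : MonoidAlgebra ℂ G :=
  (Nat.card H : ℂ)⁻¹ • ∑ g with g ∈ H, MonoidAlgebra.single g 1

open Classical in
theorem coeff_subgroupAverage (H : Subgroup G) (g : G) :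
    (subgroupAverage H).coeff g = if g ∈ H then (Nat.card H : ℂ)⁻¹ else 0 := by
  simp [subgroupAverage, Finsupp.single_apply, Finset.sum_ite_eq']

theorem subgroupAverage_bot : subgroupAverage (⊥ : Subgroup G) = 1 := by
  classical
  ext g
  rw [coeff_subgroupAverage, MonoidAlgebra.one_def]
  simp [Finsupp.single_apply, eq_comm]

theorem single_mul_subgroupAverage {H : Subgroup G} {g : G} (hg : g ∈ H) :
    MonoidAlgebra.single g 1 * subgroupAverage H = subgroupAverage H := by
  classical
  ext h
  rw [MonoidAlgebra.coeff_single_mul_apply, coeff_subgroupAverage, coeff_subgroupAverage,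
    Subgroup.mul_mem_cancel_left H (H.inv_mem hg), one_mul]

theorem subgroupAverage_mul_of_fixed {H : Subgroup G} {x : MonoidAlgebra ℂ G}
    (hx : ∀ h ∈ H, MonoidAlgebra.single h 1 * x = x) : subgroupAverage H * x = x := by
  classical
  have hcard : ((Finset.univ.filter fun g => g ∈ H).card : ℂ) = Nat.card H := by
    rw [Nat.card_eq_fintype_card, Fintype.card_subtype]
  rw [subgroupAverage, smul_mul_assoc, Finset.sum_mul,
    Finset.sum_congr rfl fun g hg => hx g (by simpa using hg), Finset.sum_const,
    ← Nat.cast_smul_eq_nsmul ℂ, hcard, smul_smul,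
    inv_mul_cancel₀ (Nat.cast_ne_zero.mpr Nat.card_pos.ne'), one_smul]

omit [Fintype G] in
theorem mem_center_of_commute_single {x : MonoidAlgebra ℂ G}
    (h : ∀ g : G, MonoidAlgebra.single g 1 * x = x * MonoidAlgebra.single g 1) :
    x ∈ Subalgebra.center ℂ (MonoidAlgebra ℂ G) := by
  rw [Subalgebra.mem_center_iff]
  intro y
  induction y using MonoidAlgebra.induction_on with
  | of g => exact h g
  | add y z hy hz => rw [add_mul, mul_add, hy, hz]
  | smul r y hy => rw [smul_mul_assoc, mul_smul_comm, hy]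

theorem subgroupAverage_mem_center (H : Subgroup G) [hH : H.Normal] :
    subgroupAverage H ∈ Subalgebra.center ℂ (MonoidAlgebra ℂ G) := by
  classical
  refine mem_center_of_commute_single fun g => ?_
  ext h
  rw [MonoidAlgebra.coeff_single_mul_apply, MonoidAlgebra.coeff_mul_single_apply,
    coeff_subgroupAverage, coeff_subgroupAverage, hH.mem_comm_iff, one_mul, mul_one]

/-- The product is fixed by `H` and by `K`, hence by `HK`, so the average over `H ⊔ K` absorbs it;
conversely that average absorbs each factor. -/
theorem subgroupAverage_sup (H K : Subgroup G) [H.Normal] [K.Normal] :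
    subgroupAverage (H ⊔ K) = subgroupAverage H * subgroupAverage K := by
  have comm : subgroupAverage H * subgroupAverage K = subgroupAverage K * subgroupAverage H :=
    Subalgebra.mem_center_iff.mp (subgroupAverage_mem_center K) _
  have fixed : ∀ g ∈ H ⊔ K, MonoidAlgebra.single g 1 * (subgroupAverage H * subgroupAverage K) =
      subgroupAverage H * subgroupAverage K := by
    intro g hg
    rw [← SetLike.mem_coe, Subgroup.mul_normal] at hg
    obtain ⟨h, hh, k, hk, rfl⟩ := hg
    dsimp only
    rw [show (MonoidAlgebra.single (h * k) 1 : MonoidAlgebra ℂ G) =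
      MonoidAlgebra.single h 1 * MonoidAlgebra.single k 1 by simp, mul_assoc]
    nth_rewrite 1 [comm]
    rw [← mul_assoc (MonoidAlgebra.single k 1), single_mul_subgroupAverage hk, ← comm, ← mul_assoc,
      single_mul_subgroupAverage hh]
  have center := Subalgebra.mem_center_iff.mp (subgroupAverage_mem_center (H ⊔ K))
  have absorb : ∀ L ≤ H ⊔ K, subgroupAverage L * subgroupAverage (H ⊔ K) =
      subgroupAverage (H ⊔ K) := fun L hL =>
    subgroupAverage_mul_of_fixed fun l hl => single_mul_subgroupAverage (hL hl)
  rw [← subgroupAverage_mul_of_fixed fixed, ← center, mul_assoc, absorb K le_sup_right,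
    absorb H le_sup_left]

end Average

/-! ### The sets `H°` and their indicators -/

section Circ

variable {G : Type*} [Group G] [Finite G] {A : Sublattice (Subgroup G)}

/-- A minimal member containing `g` is least, by closure under intersection. -/
theorem exists_le_iff_mem (htop : ⊤ ∈ A) (g : G) :
    ∃ K : A, ∀ H : A, g ∈ (H : Subgroup G) ↔ K ≤ H := by
  obtain ⟨K, hK⟩ := (Set.toFinite {H : A | g ∈ (H : Subgroup G)}).exists_minimal
    ⟨⟨⊤, htop⟩, Subgroup.mem_top g⟩
  have hgK : g ∈ (K : Subgroup G) := hK.prop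
  refine ⟨K, fun H => ⟨fun hg => ?_, fun h => h hgK⟩⟩
  have hinf : g ∈ ((K ⊓ H : A) : Subgroup G) := ⟨hgK, hg⟩
  exact (hK.le_of_le hinf inf_le_left).trans inf_le_right

omit [Finite G] in
theorem mem_circ_iff {H : A} {g : G} :
    g ∈ circ (A : Set (Subgroup G)) H ↔
      g ∈ (H : Subgroup G) ∧ ∀ K : A, K < H → g ∉ (K : Subgroup G) := by
  simp only [circ, Set.mem_sdiff, SetLike.mem_coe, Set.mem_iUnion, Set.mem_ofPred_eq, not_exists,
    and_imp]
  exact and_congr_right fun _ => ⟨fun h K hK => h K K.2 hK, fun h K hA hK => h ⟨K, hA⟩ hK⟩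

/-- Every element lies in exactly one of the sets `H°`; it is the one with `H` the least member of
`A` containing the element. -/
theorem exists_mem_circ_iff (htop : ⊤ ∈ A) (g : G) :
    ∃ K : A, (∀ H : A, g ∈ (H : Subgroup G) ↔ K ≤ H) ∧
      ∀ H : A, g ∈ circ (A : Set (Subgroup G)) H ↔ H = K := by
  obtain ⟨K, hK⟩ := exists_le_iff_mem htop g
  refine ⟨K, hK, fun H => ?_⟩
  rw [mem_circ_iff, hK]
  constructor
  · rintro ⟨h1, h2⟩
    by_contra hne
    exact h2 K (lt_of_le_of_ne h1 (Ne.symm hne)) ((hK K).mpr le_rfl)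
  · rintro rfl
    exact ⟨le_rfl, fun M hM hg => hM.not_ge ((hK M).mp hg)⟩

/-- The indicator function of a member of `A`. -/
noncomputable def memIndicator (H : A) : G → ℂ :=
  ((H : Subgroup G) : Set G).indicator 1

/-- The indicator function of `H°`. -/
noncomputable def circIndicator (H : A) : G → ℂ :=
  (circ (A : Set (Subgroup G)) H).indicator 1

-- The order is reversed because indicators turn intersections, not products of subgroups, into
-- products; this fits the same Möbius lemmas.
open Classical in
theorem memIndicator_eq_sum [Fintype A] (htop : ⊤ ∈ A) (H : Aᵒᵈ) :
    memIndicator (OrderDual.ofDual H) = ∑ K with H ≤ K, circIndicator (OrderDual.ofDual K) := by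
  ext g
  obtain ⟨K, hK, hcirc⟩ := exists_mem_circ_iff htop g
  simp only [memIndicator, circIndicator, Finset.sum_apply, Set.indicator_apply, hcirc,
    SetLike.mem_coe, hK, Pi.one_apply, Finset.sum_filter]
  rw [Finset.sum_eq_single (OrderDual.toDual K)]
  · simp [OrderDual.le_toDual]
  · intro b _ hb
    have : OrderDual.ofDual b ≠ K := fun h => hb h
    simp [this]
  · simp

end Circ

/-! ### Equality of the two cardinalities -/

section Count

variable {G : Type*} [Group G] [Fintype G] {A : Sublattice (Subgroup G)}

open Classical in
/-- The primitive idempotents cut out by `A` are as many as the sets `H°`. -/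
theorem card_idempotents_eq_card_circ [Fintype A] (htop : ⊤ ∈ A)
    (hnormal : ∀ H : A, (H : Subgroup G).Normal) {f : A → MonoidAlgebra ℂ G}
    (hf : ∀ H : A, subgroupAverage (H : Subgroup G) = ∑ K with H ≤ K, f K) :
    Nat.card {H : A // f H ≠ 0} =
      Nat.card {H : A // (circ (A : Set (Subgroup G)) H).Nonempty} := by
  have hmul (H K : A) : subgroupAverage ((H ⊔ K : A) : Subgroup G) =
      subgroupAverage (H : Subgroup G) * subgroupAverage (K : Subgroup G) :=
    have := hnormal H
    have := hnormal K
    subgroupAverage_sup _ _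
  rw [← finrank_span_orthogonal (moebius_mul_moebius hmul hf), span_eq_of_eq_sum_ge hf]
  have hmul' (H K : Aᵒᵈ) : memIndicator (OrderDual.ofDual (H ⊔ K)) =
      memIndicator (OrderDual.ofDual H) * memIndicator (OrderDual.ofDual K) :=
    Set.inter_indicator_one
  have hcount := finrank_span_orthogonal (moebius_mul_moebius hmul' (memIndicator_eq_sum htop))
  rw [span_eq_of_eq_sum_ge (memIndicator_eq_sum htop)] at hcount
  have hcard : Nat.card {H : Aᵒᵈ // circIndicator (OrderDual.ofDual H) ≠ 0} =
      Nat.card {H : A // (circ (A : Set (Subgroup G)) H).Nonempty} := by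
    refine Nat.card_congr (OrderDual.ofDual.subtypeEquiv fun H => ?_)
    simp [circIndicator, Set.nonempty_iff_ne_empty]
  rw [← hcard, ← hcount]
  let φ : MonoidAlgebra ℂ G ≃ₗ[ℂ] (G → ℂ) :=
    (MonoidAlgebra.coeffLinearEquiv ℂ).trans (Finsupp.linearEquivFunOnFinite ℂ ℂ G)
  rw [← LinearEquiv.finrank_map_eq φ, Submodule.map_span]
  have hne (H : A) : (Nat.card (H : Subgroup G) : ℂ) ≠ 0 :=
    Nat.cast_ne_zero.mpr Nat.card_pos.ne'
  have key (H : A) : memIndicator H =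
      (Nat.card (H : Subgroup G) : ℂ) • φ (subgroupAverage (H : Subgroup G)) := by
    ext g
    change _ = (Nat.card (H : Subgroup G) : ℂ) • (subgroupAverage (H : Subgroup G)).coeff g
    simp [memIndicator, coeff_subgroupAverage, Set.indicator_apply]
  have hspan : Submodule.span ℂ (φ '' Set.range fun H : A => subgroupAverage (H : Subgroup G)) =
      Submodule.span ℂ (Set.range fun H : Aᵒᵈ => memIndicator (OrderDual.ofDual H)) := by
    apply le_antisymm <;> rw [Submodule.span_le]
    · rintro _ ⟨_, ⟨H, rfl⟩, rfl⟩
      rw [SetLike.mem_coe, ← Submodule.smul_mem_iff _ (hne H)]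
      exact Submodule.subset_span ⟨OrderDual.toDual H, key H⟩
    · rintro _ ⟨H, rfl⟩
      dsimp only
      rw [key]
      exact Submodule.smul_mem _ _ (Submodule.subset_span ⟨_, ⟨OrderDual.ofDual H, rfl⟩, rfl⟩)
  exact congrArg (fun p : Submodule ℂ (G → ℂ) => Module.finrank ℂ p) hspan

end Count

/-! ### Passage to representations on `Fin n → ℂ` -/

section Transport

variable {G V W : Type*} [Group G] [AddCommGroup V] [Module ℂ V] [AddCommGroup W] [Module ℂ W]

/-- Transport of a representation along a linear equivalence. -/
def transportRep (e : V ≃ₗ[ℂ] W) (ρ : Representation ℂ G V) : Representation ℂ G W where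
  toFun g := e.conj (ρ g)
  map_one' := by ext; simp [LinearEquiv.conj_apply]
  map_mul' g h := by ext; simp [LinearEquiv.conj_apply]

/-- A representation is equivalent to its transports. -/
def transportRepEquiv (e : V ≃ₗ[ℂ] W) (ρ : Representation ℂ G V) :
    ρ.Equiv (transportRep e ρ) :=
  Representation.Equiv.mk e fun g => by ext; simp [transportRep, LinearEquiv.conj_apply]

theorem isIrreducible_of_equiv {ρ : Representation ℂ G V} {σ : Representation ℂ G W}
    (φ : ρ.Equiv σ) (h : ρ.IsIrreducible) : σ.IsIrreducible := by
  rw [Representation.irreducible_iff_isSimpleModule_asModule] at h ⊢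
  let ψ := Representation.IntertwiningMap.equivLinearMapAsModule ρ σ φ.toIntertwiningMap
  have hψ : Function.Bijective ψ := φ.toLinearEquiv.bijective
  exact IsSimpleModule.congr (LinearEquiv.ofBijective ψ hψ).symm

theorem isCharacter_character [FiniteDimensional ℂ V] (ρ : Representation ℂ G V) :
    IsCharacter ρ.character :=
  ⟨_, _, Representation.char_iso (transportRepEquiv (Module.finBasis ℂ V).equivFun ρ)⟩

theorem character_mem_Irr [FiniteDimensional ℂ V] {ρ : Representation ℂ G V}
    (h : ρ.IsIrreducible) : ρ.character ∈ Irr G :=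
  let φ := transportRepEquiv (Module.finBasis ℂ V).equivFun ρ
  ⟨_, _, isIrreducible_of_equiv φ h, Representation.char_iso φ⟩

end Transport

/-! ### Characters evaluated on central idempotents -/

section Pairing

variable {G V : Type*} [Group G] [Fintype G] [AddCommGroup V] [Module ℂ V]

/-- The linear extension of a function on `G` to the group algebra. -/
def extend (ψ : G → ℂ) (x : MonoidAlgebra ℂ G) : ℂ :=
  ∑ g, x.coeff g * ψ g

omit [Group G] in
theorem extend_add (ψ θ : G → ℂ) (x : MonoidAlgebra ℂ G) :
    extend (ψ + θ) x = extend ψ x + extend θ x := by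
  simp [extend, mul_add, Finset.sum_add_distrib]

theorem extend_character (ρ : Representation ℂ G V) (x : MonoidAlgebra ℂ G) :
    extend ρ.character x = LinearMap.trace ℂ V (ρ.asAlgebraHom x) := by
  rw [Representation.asAlgebraHom_def, MonoidAlgebra.lift_apply, Finsupp.sum_fintype _ _ (by simp),
    map_sum]
  simp [extend, Representation.character]

variable [FiniteDimensional ℂ V] (ρ : Representation ℂ G V) {x : MonoidAlgebra ℂ G}

include ρ in
theorem exists_natCast_eq_extend_character (hx : IsIdempotentElem x) :
    ∃ n : ℕ, extend ρ.character x = n := by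
  rw [extend_character]
  exact ⟨_, LinearMap.IsProj.trace (LinearMap.IsIdempotentElem.isProj_range _
    (hx.map ρ.asAlgebraHom))⟩

/-- The trace of an idempotent is its rank, and the characteristic is zero. -/
theorem extend_character_eq_zero_iff (hx : IsIdempotentElem x) :
    extend ρ.character x = 0 ↔ ρ.asAlgebraHom x = 0 := by
  rw [extend_character, LinearMap.IsIdempotentElem.trace_eq_zero_iff (hx.map ρ.asAlgebraHom)]

omit [Fintype G] [FiniteDimensional ℂ V] in
/-- Central elements of the group algebra with product zero do not both act nontrivially on an
irreducible representation. -/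
theorem asAlgebraHom_eq_zero_or_eq_zero {ρ : Representation ℂ G V} (hρ : ρ.IsIrreducible)
    {x y : MonoidAlgebra ℂ G} (hx : x ∈ Subalgebra.center ℂ (MonoidAlgebra ℂ G)) (hxy : y * x = 0) :
    ρ.asAlgebraHom x = 0 ∨ ρ.asAlgebraHom y = 0 := by
  let U : Subrepresentation ρ :=
    { toSubmodule := LinearMap.range (ρ.asAlgebraHom x)
      apply_mem_toSubmodule := by
        rintro g _ ⟨v, rfl⟩
        refine ⟨ρ g v, ?_⟩
        rw [← Representation.asAlgebraHom_single_one ρ g, ← Module.End.mul_apply,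
          ← Module.End.mul_apply, ← map_mul, ← map_mul, Subalgebra.mem_center_iff.mp hx] }
  rcases eq_bot_or_eq_top U with h | h
  · left
    exact LinearMap.range_eq_bot.mp (congrArg Subrepresentation.toSubmodule h)
  · right
    have htop : LinearMap.range (ρ.asAlgebraHom x) = ⊤ :=
      congrArg Subrepresentation.toSubmodule h
    ext v
    obtain ⟨w, rfl⟩ := LinearMap.range_eq_top.mp htop v
    rw [← Module.End.mul_apply, ← map_mul, hxy, map_zero]
    rfl

omit [Fintype G] [FiniteDimensional ℂ V] in
theorem coe_asAlgebraHom_toRepresentation (U : Subrepresentation ρ) (x : MonoidAlgebra ℂ G)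
    (u : U.toSubmodule) : (U.toRepresentation.asAlgebraHom x u : V) = ρ.asAlgebraHom x u := by
  induction x using MonoidAlgebra.induction_on with
  | of g =>
    rw [Representation.asAlgebraHom_of, Representation.asAlgebraHom_of]
    rfl
  | add x y hx hy => simp [hx, hy]
  | smul r x hx => simp [hx]

omit [Fintype G] in
theorem exists_isAtom_le {U : Subrepresentation ρ} (hU : U ≠ ⊥) :
    ∃ W : Subrepresentation ρ, IsAtom W ∧ W ≤ U := by
  have hmono : StrictMono (Subrepresentation.toSubmodule : Subrepresentation ρ → Submodule ℂ V) :=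
    Monotone.strictMono_of_injective (fun _ _ h => h) Subrepresentation.toSubmodule_injective
  have : WellFoundedLT (Subrepresentation ρ) := hmono.wellFoundedLT
  have := isAtomic_of_orderBot_wellFounded_lt (α := Subrepresentation ρ) wellFounded_lt
  exact (IsAtomic.eq_bot_or_exists_atom_le U).resolve_left hU

omit [Fintype G] [FiniteDimensional ℂ V] in
theorem isIrreducible_of_isAtom {W : Subrepresentation ρ} (hW : IsAtom W) :
    W.toRepresentation.IsIrreducible := by
  have hne : (⊥ : Subrepresentation W.toRepresentation) ≠ ⊤ := by
    intro h
    apply hW.1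
    apply Subrepresentation.toSubmodule_injective
    change W.toSubmodule = ⊥
    rw [eq_bot_iff]
    intro w hw
    have : (⟨w, hw⟩ : W.toSubmodule) ∈ (⊥ : Submodule ℂ W.toSubmodule) := by
      have := congrArg Subrepresentation.toSubmodule h
      change (⊥ : Submodule ℂ W.toSubmodule) = ⊤ at this
      rw [this]
      trivial
    simpa using this
  have : Nontrivial (Subrepresentation W.toRepresentation) := ⟨⟨⊥, ⊤, hne⟩⟩
  refine ⟨fun U => ?_⟩
  let U' : Subrepresentation ρ :=
    { toSubmodule := U.toSubmodule.map W.toSubmodule.subtype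
      apply_mem_toSubmodule := by
        rintro g _ ⟨u, hu, rfl⟩
        exact ⟨W.toRepresentation g u, U.apply_mem_toSubmodule g hu, rfl⟩ }
  have hle : U' ≤ W := by
    rintro _ ⟨u, _, rfl⟩
    exact u.2
  rcases hW.le_iff.mp hle with h | h
  · left
    apply Subrepresentation.toSubmodule_injective
    have h2 : U.toSubmodule.map W.toSubmodule.subtype = ⊥ :=
      congrArg Subrepresentation.toSubmodule h
    exact Submodule.map_injective_of_injective W.toSubmodule.injective_subtype
      (h2.trans (Submodule.map_bot _).symm)
  · right
    apply Subrepresentation.toSubmodule_injective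
    have h2 : U.toSubmodule.map W.toSubmodule.subtype = W.toSubmodule :=
      congrArg Subrepresentation.toSubmodule h
    change U.toSubmodule = ⊤
    rw [eq_top_iff]
    intro w _
    have hw : (w : V) ∈ U.toSubmodule.map W.toSubmodule.subtype := by
      rw [h2]
      exact w.2
    obtain ⟨u, hu, huw⟩ := hw
    rwa [← Subtype.ext huw]

end Pairing

/-! ### Ideals of the regular representation -/

section Regular

variable {G : Type*} [Group G] [Fintype G]

theorem trace_leftRegular (x : MonoidAlgebra ℂ G) :
    LinearMap.trace ℂ _ ((Representation.leftRegular ℂ G).asAlgebraHom x) =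
      Nat.card G * x.coeff 1 := by
  classical
  let b : Module.Basis G ℂ (MonoidAlgebra ℂ G) :=
    Module.Basis.ofRepr (MonoidAlgebra.coeffLinearEquiv ℂ)
  have hb (g : G) : b g = MonoidAlgebra.single g 1 := rfl
  have hr (y : MonoidAlgebra ℂ G) (g : G) : b.repr y g = y.coeff g := rfl
  rw [LinearMap.trace_eq_matrix_trace ℂ b, Matrix.trace]
  simp [LinearMap.toMatrix_apply, hb, hr, MonoidAlgebra.coeff_mul_single_apply]

/-- The subrepresentation of the regular representation generated by a central element. -/
noncomputable def regularSub (x : MonoidAlgebra ℂ G)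
    (hx : x ∈ Subalgebra.center ℂ (MonoidAlgebra ℂ G)) :
    Subrepresentation (Representation.leftRegular ℂ G) where
  toSubmodule := LinearMap.range ((Representation.leftRegular ℂ G).asAlgebraHom x)
  apply_mem_toSubmodule := by
    rintro g _ ⟨v, rfl⟩
    refine ⟨Representation.leftRegular ℂ G g v, ?_⟩
    rw [← Representation.asAlgebraHom_single_one _ g, ← Module.End.mul_apply,
      ← Module.End.mul_apply, ← map_mul, ← map_mul, Subalgebra.mem_center_iff.mp hx]

/-- A nonzero central idempotent acts nontrivially on some irreducible representation. -/
theorem exists_irr_extend_ne_zero {x : MonoidAlgebra ℂ G} (hi : IsIdempotentElem x)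
    (hx : x ∈ Subalgebra.center ℂ (MonoidAlgebra ℂ G)) (h0 : x ≠ 0) :
    ∃ χ : Irr G, extend (χ : G → ℂ) x ≠ 0 := by
  let ρ := Representation.leftRegular ℂ G
  have hne : regularSub x hx ≠ ⊥ := by
    intro h
    have hbot : LinearMap.range (ρ.asAlgebraHom x) = ⊥ :=
      congrArg Subrepresentation.toSubmodule h
    apply h0
    have := LinearMap.congr_fun (LinearMap.range_eq_bot.mp hbot) 1
    simpa [ρ] using this
  obtain ⟨W, hW, hle⟩ := exists_isAtom_le _ hne
  refine ⟨⟨_, character_mem_Irr (isIrreducible_of_isAtom _ hW)⟩, ?_⟩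
  rw [Ne, extend_character_eq_zero_iff _ hi]
  intro h
  apply hW.1
  apply Subrepresentation.toSubmodule_injective
  change W.toSubmodule = ⊥
  rw [eq_bot_iff]
  intro w hw
  obtain ⟨v, hv⟩ := hle hw
  have h1 := coe_asAlgebraHom_toRepresentation _ W x ⟨w, hw⟩
  rw [h] at h1
  change (0 : MonoidAlgebra ℂ G) = ρ.asAlgebraHom x w at h1
  rw [Submodule.mem_bot, h1]
  change ρ.asAlgebraHom x v = w at hv
  rw [← hv, ← Module.End.mul_apply, ← map_mul, hi.eq]

/-- Since `x` acts as the identity on its range, the trace of `g` there is the trace of `g x` on the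
whole group algebra. -/
theorem character_regularSub {x : MonoidAlgebra ℂ G}
    (hx : x ∈ Subalgebra.center ℂ (MonoidAlgebra ℂ G)) (hi : IsIdempotentElem x) (g : G) :
    (regularSub x hx).toRepresentation.character g = Nat.card G * x.coeff g⁻¹ := by
  let ρ := Representation.leftRegular ℂ G
  have hmem : ∀ v, ρ.asAlgebraHom (MonoidAlgebra.single g 1 * x) v ∈
      (regularSub x hx).toSubmodule := fun v => by
    rw [Subalgebra.mem_center_iff.mp hx, map_mul]
    exact ⟨_, rfl⟩
  have htr := LinearMap.trace_restrict_eq_of_forall_mem (regularSub x hx).toSubmodule _ hmem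
  rw [trace_leftRegular, MonoidAlgebra.coeff_single_mul_apply, one_mul, mul_one] at htr
  rw [← htr]
  unfold Representation.character
  congr 1
  ext v : 2
  obtain ⟨w, hw⟩ := v.2
  change ρ g v.1 = ρ.asAlgebraHom (MonoidAlgebra.single g 1 * x) v.1
  rw [map_mul, Representation.asAlgebraHom_single_one, Module.End.mul_apply, ← hw,
    ← Module.End.mul_apply (ρ.asAlgebraHom x), ← map_mul, hi.eq]

theorem extend_character_regularSub {x y : MonoidAlgebra ℂ G}
    (hx : x ∈ Subalgebra.center ℂ (MonoidAlgebra ℂ G)) (hi : IsIdempotentElem x)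
    (hyx : y * x = 0) : extend (regularSub x hx).toRepresentation.character y = 0 := by
  -- Up to the factor `|G|`, pairing with this character reads off the coefficient of `y * x` at the
  -- identity.
  have h : extend (fun g => x.coeff g⁻¹) y = (y * x).coeff 1 := by
    classical
    have hy : y = ∑ g, y.coeff g • MonoidAlgebra.single g 1 := by
      ext g
      simp
    conv_rhs => rw [hy]
    simp [extend, Finset.sum_mul, MonoidAlgebra.coeff_single_mul_apply]
  have h2 : extend (regularSub x hx).toRepresentation.character y =
      Nat.card G * extend (fun g => x.coeff g⁻¹) y := by
    simp only [extend, character_regularSub hx hi, Finset.mul_sum]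
    exact Finset.sum_congr rfl fun g _ => by ring
  rw [h2, h, hyx]
  simp

end Regular

/-! ### Assembling the supercharacter theory -/

section Lattice

variable {G : Type*} [Group G] [Fintype G] {A : Sublattice (Subgroup G)}

/-- The irreducible characters that do not vanish on `f H`. -/
def irrBlock (f : A → MonoidAlgebra ℂ G) (H : A) : Set (Irr G) :=
  {χ | extend (χ : G → ℂ) (f H) ≠ 0}

/-- Existence holds because the `f H` sum to 1; uniqueness because the range of a central element is
invariant, so by irreducibility two with product zero cannot both act nontrivially. -/
theorem existsUnique_mem_irrBlock [Fintype A] [DecidableEq A] {f : A → MonoidAlgebra ℂ G}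
    (hcenter : ∀ H, f H ∈ Subalgebra.center ℂ (MonoidAlgebra ℂ G))
    (horth : ∀ H K, f H * f K = if H = K then f K else 0) (hsum : ∑ H, f H = 1) (χ : Irr G) :
    ∃! H, χ ∈ irrBlock f H := by
  obtain ⟨n, ρ, hρ, hχ⟩ := χ.2
  have hmem (H : A) : χ ∈ irrBlock f H ↔ ρ.asAlgebraHom (f H) ≠ 0 := by
    have hi : IsIdempotentElem (f H) := (horth H H).trans (if_pos rfl)
    rw [irrBlock, Set.mem_ofPred_eq, hχ, Ne, extend_character_eq_zero_iff ρ hi]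
  simp only [hmem]
  have hex : ∃ H, ρ.asAlgebraHom (f H) ≠ 0 := by
    by_contra! h
    have h1 : ρ.asAlgebraHom 1 = 0 := by
      rw [← hsum, map_sum]
      exact Finset.sum_eq_zero fun H _ => h H
    apply bot_ne_top (α := Subrepresentation ρ)
    apply Subrepresentation.toSubmodule_injective
    change (⊥ : Submodule ℂ (Fin n → ℂ)) = ⊤
    rw [eq_comm, eq_bot_iff]
    intro v _
    rw [map_one] at h1
    exact LinearMap.congr_fun h1 v
  obtain ⟨H, hH⟩ := hex
  refine ⟨H, hH, fun K hK => ?_⟩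
  by_contra hne
  have h0 : f K * f H = 0 := by rw [horth, if_neg hne]
  exact (asAlgebraHom_eq_zero_or_eq_zero hρ (hcenter H) h0).elim hH hK

/-- The sets `H°`, for `H` in a lattice of normal subgroups, are the superclasses of a
supercharacter theory. -/
theorem isSuperclassTheory_circ (hbot : ⊥ ∈ A) (htop : ⊤ ∈ A)
    (hnormal : ∀ H : A, (H : Subgroup G).Normal) :
    IsSuperclassTheory {C : Set G | C.Nonempty ∧
      ∃ H ∈ (A : Set (Subgroup G)), C = circ (A : Set (Subgroup G)) H} := by
  classical
  have : Fintype A := Fintype.ofFinite A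
  obtain ⟨f, hf⟩ := exists_eq_sum_ge fun H : A => subgroupAverage (H : Subgroup G)
  have hmul (H K : A) : subgroupAverage ((H ⊔ K : A) : Subgroup G) =
      subgroupAverage (H : Subgroup G) * subgroupAverage (K : Subgroup G) :=
    have := hnormal H
    have := hnormal K
    subgroupAverage_sup _ _
  have horth (H K : A) : f H * f K = if H = K then f K else 0 := by
    convert moebius_mul_moebius hmul (fun a => by convert hf a) H K
  have hi (H : A) : IsIdempotentElem (f H) := (horth H H).trans (if_pos rfl)
  have hcenter : ∀ H, f H ∈ Subalgebra.center ℂ (MonoidAlgebra ℂ G) :=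
    mem_of_eq_sum_ge (fun a => by convert hf a)
      (Subalgebra.toSubmodule (Subalgebra.center ℂ (MonoidAlgebra ℂ G)))
      fun H => have := hnormal H; subgroupAverage_mem_center (H : Subgroup G)
  have hsum : ∑ H, f H = 1 := by
    rw [← subgroupAverage_bot]
    refine Eq.trans (Finset.sum_congr ?_ fun _ _ => rfl) (hf ⟨⊥, hbot⟩).symm
    ext H
    have : (⟨⊥, hbot⟩ : A) ≤ H := (bot_le : ⊥ ≤ (H : Subgroup G))
    simp [this]
  have hblock := existsUnique_mem_irrBlock hcenter horth hsum
  have hne {H : A} (h : f H ≠ 0) : (irrBlock f H).Nonempty :=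
    exists_irr_extend_ne_zero (hi H) (hcenter H) h
  have hne' {H : A} {χ : Irr G} (h : χ ∈ irrBlock f H) : f H ≠ 0 := by
    intro h0
    apply h
    simp [extend, h0]
  refine ⟨irrBlock f '' {H | f H ≠ 0}, ⟨?_, ?_⟩, ⟨?_, ?_⟩, ?_, ?_, ?_⟩
  · rintro ⟨H, hH, h⟩
    exact (hne hH).ne_empty h
  · intro χ
    obtain ⟨H, hH, huniq⟩ := hblock χ
    refine ⟨irrBlock f H, ⟨⟨H, hne' hH, rfl⟩, hH⟩, ?_⟩
    rintro _ ⟨⟨K, hK, rfl⟩, hχ⟩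
    rw [huniq K hχ]
  · rintro ⟨h, -⟩
    exact Set.not_nonempty_empty h
  · intro g
    obtain ⟨K, -, hK⟩ := exists_mem_circ_iff htop g
    have hg := (hK K).mpr rfl
    refine ⟨circ (A : Set (Subgroup G)) K, ⟨⟨⟨g, hg⟩, K, K.2, rfl⟩, hg⟩, ?_⟩
    rintro _ ⟨⟨-, H, hH, rfl⟩, hgH⟩
    rw [← (hK ⟨H, hH⟩).mp hgH]
  · have hclasses : {C : Set G | C.Nonempty ∧
        ∃ H ∈ (A : Set (Subgroup G)), C = circ (A : Set (Subgroup G)) H} =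
        (fun H : A => circ (A : Set (Subgroup G)) H) ''
          {H | (circ (A : Set (Subgroup G)) H).Nonempty} := by
      ext C
      constructor
      · rintro ⟨hC, H, hH, rfl⟩
        exact ⟨⟨H, hH⟩, hC, rfl⟩
      · rintro ⟨H, hC, rfl⟩
        exact ⟨hC, H, H.2, rfl⟩
    have hinj : Set.InjOn (fun H : A => circ (A : Set (Subgroup G)) H)
        {H | (circ (A : Set (Subgroup G)) H).Nonempty} := by
      rintro H ⟨g, hg⟩ K _ hHK
      obtain ⟨M, -, hM⟩ := exists_mem_circ_iff htop g
      rw [(hM H).mp hg, (hM K).mp (Set.ext_iff.mp hHK g |>.mp hg)]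
    have hinj' : Set.InjOn (irrBlock f) {H | f H ≠ 0} := by
      intro H hH K _ hHK
      obtain ⟨χ, hχ⟩ := hne hH
      exact (hblock χ).unique hχ (hHK ▸ hχ)
    rw [hclasses, hinj.encard_image, hinj'.encard_image, ← (Set.toFinite _).cast_ncard_eq,
      ← (Set.toFinite _).cast_ncard_eq]
    have hcard := card_idempotents_eq_card_circ htop hnormal (fun a => by convert hf a)
    exact congrArg Nat.cast hcard.symm
  · rintro _ ⟨H, hH, rfl⟩
    refine ⟨(regularSub (f H) (hcenter H)).toRepresentation.character,
      isCharacter_character _, ?_, ?_, ?_⟩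
    · intro h0
      apply hH
      ext g
      have := congrFun h0 g⁻¹
      rw [character_regularSub (hcenter H) (hi H), inv_inv] at this
      simpa using this
    · rintro χ ⟨θ, ⟨n, σ, rfl⟩, hψ⟩
      obtain ⟨K, hK, -⟩ := hblock χ
      by_cases hKH : K = H
      · exact hKH ▸ hK
      · exfalso
        have h0 := extend_character_regularSub (hcenter H) (hi H) (y := f K)
          (by rw [horth, if_neg hKH])
        rw [hψ, extend_add] at h0
        obtain ⟨m, ρ, -, hχ⟩ := χ.2
        obtain ⟨a, ha⟩ := exists_natCast_eq_extend_character ρ (hi K)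
        obtain ⟨b, hb⟩ := exists_natCast_eq_extend_character σ (hi K)
        rw [irrBlock, Set.mem_ofPred_eq] at hK
        rw [hχ, ha] at hK h0
        rw [hb] at h0
        -- Both summands are ranks, so no cancellation can occur between a constituent and the rest.
        have : a + b = 0 := by exact_mod_cast h0
        apply hK
        rw [Nat.cast_eq_zero]
        omega
    · rintro _ ⟨-, C, hC, rfl⟩ g hg h hh
      rw [character_regularSub (hcenter H) (hi H), character_regularSub (hcenter H) (hi H)]
      congr 1
      obtain ⟨K, hK, hKc⟩ := exists_mem_circ_iff htop g
      obtain ⟨L, hL, hLc⟩ := exists_mem_circ_iff htop h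
      have hKL : K = L := by
        rw [← (hKc ⟨C, hC⟩).mp hg, (hLc ⟨C, hC⟩).mp hh]
      subst hKL
      -- Every average lies in `p`, because `g` and `h` belong to the same members of `A`; hence so
      -- does `f H`.
      let p : Submodule ℂ (MonoidAlgebra ℂ G) :=
        { carrier := {x | x.coeff g⁻¹ = x.coeff h⁻¹}
          zero_mem' := by simp
          add_mem' := fun {x y} hx hy => by
            simp only [Set.mem_ofPred_eq] at hx hy ⊢
            simp [hx, hy]
          smul_mem' := fun c x hx => by
            simp only [Set.mem_ofPred_eq] at hx ⊢
            simp [hx] }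
      refine mem_of_eq_sum_ge (fun a => by convert hf a) p (fun M => ?_) H
      change (subgroupAverage (M : Subgroup G)).coeff g⁻¹ =
        (subgroupAverage (M : Subgroup G)).coeff h⁻¹
      simp only [coeff_subgroupAverage, inv_mem_iff, hK, hL]
  · have h1 : ({1} : Set G) = circ (A : Set (Subgroup G)) (⊥ : Subgroup G) := by
      simp [circ]
    exact ⟨Set.singleton_nonempty 1, ⊥, hbot, h1⟩

end Lattice

end SuperChar

theorem mainTheorem1 {G : Type*} [Group G] [Finite G] {k : ℕ} (N : Fin k → Subgroup G)
    (hN : ∀ i, (N i).Normal) :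
    SuperChar.IsSuperclassTheory
      {C : Set G | C.Nonempty ∧
        ∃ H ∈ SuperChar.familyA N, C = SuperChar.circ (SuperChar.familyA N) H} := by
  have := Fintype.ofFinite G
  have hnormal : ∀ H, SuperChar.GeneratedFamily (Set.range N) H → H.Normal := by
    intro H hH
    induction hH with
    | bot => infer_instance
    | top => infer_instance
    | of H h =>
      obtain ⟨i, rfl⟩ := h
      exact hN i
    | mul H K L _ _ hL hH hK =>
      rw [← Subgroup.mul_normal, SetLike.coe_set_eq] at hL
      rw [hL]
      infer_instance
    | inter H K _ _ hH hK => infer_instance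
  -- All members are normal, so products are joins and the family is a sublattice.
  let A : Sublattice (Subgroup G) :=
    { carrier := SuperChar.familyA N
      supClosed' := fun H hH K hK => by
        have := hnormal K hK
        exact .mul H K _ hH hK (Subgroup.mul_normal H K)
      infClosed' := fun H hH K hK => .inter H K hH hK }
  exact SuperChar.isSuperclassTheory_circ (A := A) .bot .top fun H => hnormal H H.2
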